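/- A convex body in a Euclidean space is a compact convex set with nonempty interior; it is symmetric if it is invariant under reflection in some point. A convex body $K$ in an $n$-dimensional Euclidean space $E$ is a body of revolution if there is a line $L$ in $E$ such that the section of $K$ by each affine hyperplane $\Delta$ of $E$ orthogonal to $L$ is empty, a single point, or an $(n-1)$-dimensional closed Euclidean ball in $\Delta$ centered at $\Delta\cap L$. A convex body is an affine body of revolution if it is the image of a body of revolution under an invertible affine map. An ellipsoid in $E$ is the image of the closed unit ball of $E$ under an invertible affine map. Theorem. Let $n\ge 4$ and let $B\subset\mathbb{R}^{n+1}$ be a symmetric convex body. Suppose that for every $n$-dimensional linear subspace $H\subset\mathbb{R}^{n+1}$ the orthogonal projection of $B$ onto $H$ is an affine body of revolution in $H$. Then there is an $n$-dimensional linear subspace $H\subset\mathbb{R}^{n+1}$ such that the orthogonal projection of $B$ onto $H$ is an ellipsoid in $H$. -/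

import Mathlib

/-- A convex body in a Euclidean space: a compact convex set with nonempty interior. -/
structure IsConvexBody {E : Type*} [NormedAddCommGroup E] [InnerProductSpace ℝ E]
    (K : Set E) : Prop where
  isCompact : IsCompact K
  convex : Convex ℝ K
  nonempty_interior : (interior K).Nonempty

/-- `K` is (centrally) symmetric: it is invariant under the point reflection in some centre `c`
(not necessarily the origin). -/
def IsCentrallySymmetric {E : Type*} [NormedAddCommGroup E] [InnerProductSpace ℝ E]
    (K : Set E) : Prop :=
  ∃ c : E, Equiv.pointReflection c '' K = K

/-- The affine line `L` is an axis of revolution of `K`: each section of `K` by an affine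
hyperplane orthogonal to `L` is a Euclidean ball of that hyperplane, centred at the point `x`
where the hyperplane meets `L`. A negative `r` gives an empty section, `r = 0` a single point. -/
def IsAxisOfRevolution {E : Type*} [NormedAddCommGroup E] [InnerProductSpace ℝ E]
    (L : AffineSubspace ℝ E) (K : Set E) : Prop :=
  (L : Set E).Nonempty ∧ Module.finrank ℝ L.direction = 1 ∧
    ∀ x ∈ L, ∃ r : ℝ,
      K ∩ (AffineSubspace.mk' x L.directionᗮ : Set E) =
        Metric.closedBall x r ∩ (AffineSubspace.mk' x L.directionᗮ : Set E)

/-- A body of revolution: a convex body that admits an axis of revolution. -/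
def IsBodyOfRevolution {E : Type*} [NormedAddCommGroup E] [InnerProductSpace ℝ E]
    (K : Set E) : Prop :=
  IsConvexBody K ∧ ∃ L : AffineSubspace ℝ E, IsAxisOfRevolution L K

/-- An affine body of revolution: a convex body affinely equivalent to a body of revolution. -/
def IsAffineBodyOfRevolution {E : Type*} [NormedAddCommGroup E] [InnerProductSpace ℝ E]
    (K : Set E) : Prop :=
  IsConvexBody K ∧ ∃ f : E ≃ᵃ[ℝ] E, IsBodyOfRevolution (f '' K)

/-- A (solid, nondegenerate) ellipsoid: the image of the closed unit ball under an invertible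
affine map. -/
def IsEllipsoid {E : Type*} [NormedAddCommGroup E] [InnerProductSpace ℝ E]
    (K : Set E) : Prop :=
  ∃ f : E ≃ᵃ[ℝ] E, K = f '' Metric.closedBall (0 : E) 1

/-- The image of `B` under the orthogonal projection onto the linear subspace `H`, as a subset of
the Euclidean space `H`. -/
noncomputable def orthProj {E : Type*} [NormedAddCommGroup E] [InnerProductSpace ℝ E]
    [FiniteDimensional ℝ E] (H : Submodule ℝ E) (B : Set E) : Set H :=
  H.orthogonalProjectionOnto '' B

/-!
Let `N` be the support function of `B` with respect to its centre. On a hyperplane `H`, `N` is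
the support function of the projection of `B` to `H`, so the hypothesis says that `N` on `H`
depends only on a Euclidean norm and one linear form `ℓ` (`exists_isRotationInvariant`), and the
projection is an ellipsoid as soon as `N` is a Euclidean norm on `H` (`isEllipsoid_of_support`).
It remains to find a hyperplane on which `N` is Euclidean
(`IsGauge.exists_euclidean_hyperplane`).

Suppose there is none. For each nonzero `x`, let `p x` represent the linear form that belongs to
the hyperplane orthogonal to `x`, so that the equator of that hyperplane is the orthogonal
complement of the plane `P x` spanned by `x` and `p x`. If `N` is not Euclidean on the section `W`
orthogonal to `x` and `y`, which has dimension at least three, then `N` has only one equator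
on `W` (`satisfiesParallelogram_of_linearIndependent`), and therefore `P x` and `P y` intersect
nontrivially. Moreover `N` is not Euclidean on `W` if `W` contains the axis of the hyperplane
orthogonal to `y` (`IsRotationInvariant.exists_eq_norm`).

Given `y` and `y'`, choose `x₀` orthogonal to `y`, `y'` and to both axes. For all `x` near `x₀`
the plane `P x` then meets both `P y` and `P y'`. If these two had trivial intersection, `P x`,
which contains `x`, would lie in their four-dimensional sum, which does not contain an open set. So any two of
the planes `P x` intersect, and hence they all contain a common vector `z`
(`exists_common_vector`). Consequently every section orthogonal to `z` and some `x` independent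
of `z` is the equator of a hyperplane, on which `N` is Euclidean. Any two vectors orthogonal to
`z` lie in such a section, so `N` satisfies the parallelogram identity on the hyperplane
orthogonal to `z`: a contradiction.

The uniqueness of the equator in dimension at least three uses a Euclidean structure that is
preserved by all linear automorphisms of `N`, the `L²` norm of linear forms on the polar body
(`IsGauge.exists_invariant_norm`). Both rotation invariances may be expressed by this single
structure (`IsRotationInvariant.of_invariant_norm`), and two different axes then make `N`
constant on its unit sphere (`eq_const_mul_of_two_axes`).
-/

open scoped RealInnerProductSpace

/-! ### Gauges and affine rotation invariance -/

/-- A positively homogeneous even function that is continuous and positive away from the origin: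
the properties of a norm on a finite-dimensional space that the argument uses. -/
structure IsGauge {E : Type*} [NormedAddCommGroup E] [InnerProductSpace ℝ E]
    (N : E → ℝ) : Prop where
  continuous : Continuous N
  smul : ∀ (t : ℝ) (u : E), N (t • u) = |t| * N u
  pos : ∀ u : E, u ≠ 0 → 0 < N u

/-- `N` is invariant under the affine rotations determined by the Euclidean norm `‖A ·‖` and the
linear form `ℓ`: its value at `u` depends only on `‖A u‖` and `ℓ u`. The hyperplane `ker ℓ` is the
equator. The form `ℓ` may vanish, and then `N` is a multiple of `‖A ·‖`. -/
structure IsRotationInvariant {E F : Type*} [NormedAddCommGroup E] [InnerProductSpace ℝ E]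
    [NormedAddCommGroup F] [InnerProductSpace ℝ F]
    (N : E → ℝ) (A : E →ₗ[ℝ] F) (ℓ : E →ₗ[ℝ] ℝ) : Prop where
  injective : Function.Injective A
  eq_of_eq : ∀ u v : E, ‖A u‖ = ‖A v‖ → ℓ u = ℓ v → N u = N v

/-- The parallelogram identity for a real-valued function. -/
def SatisfiesParallelogram {E : Type*} [AddCommGroup E] (N : E → ℝ) : Prop :=
  ∀ u v : E, N (u + v) ^ 2 + N (u - v) ^ 2 = 2 * (N u ^ 2 + N v ^ 2)

section Abstract

variable {E F G : Type*} [NormedAddCommGroup E] [InnerProductSpace ℝ E]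
  [NormedAddCommGroup F] [InnerProductSpace ℝ F] [NormedAddCommGroup G] [InnerProductSpace ℝ G]

theorem IsGauge.zero {N : E → ℝ} (hN : IsGauge N) : N 0 = 0 := by
  simpa using hN.smul 0 0

theorem IsGauge.nonneg {N : E → ℝ} (hN : IsGauge N) (u : E) : 0 ≤ N u := by
  rcases eq_or_ne u 0 with rfl | h
  · exact hN.zero.ge
  · exact (hN.pos u h).le

theorem IsGauge.comp {N : E → ℝ} (hN : IsGauge N) (T : G →L[ℝ] E)
    (hT : Function.Injective T) : IsGauge (N ∘ T) where
  continuous := hN.continuous.comp T.continuous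
  smul t u := by simp [hN.smul]
  pos u hu := hN.pos _ ((map_ne_zero_iff T hT).2 hu)

theorem IsRotationInvariant.comp {N : E → ℝ} {A : E →ₗ[ℝ] F} {ℓ : E →ₗ[ℝ] ℝ}
    (h : IsRotationInvariant N A ℓ) (T : G →ₗ[ℝ] E) (hT : Function.Injective T) :
    IsRotationInvariant (N ∘ T) (A ∘ₗ T) (ℓ ∘ₗ T) where
  injective := h.injective.comp hT
  eq_of_eq _ _ h1 h2 := h.eq_of_eq _ _ h1 h2

theorem isGauge_norm_comp [FiniteDimensional ℝ E] (S : E →ₗ[ℝ] F) (hS : Function.Injective S) :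
    IsGauge fun u => ‖S u‖ where
  continuous := (LinearMap.continuous_of_finiteDimensional S).norm
  smul t u := by simp [norm_smul]
  pos u hu := norm_pos_iff.2 ((map_ne_zero_iff S hS).2 hu)

theorem IsRotationInvariant.eq_const_mul {N : E → ℝ} (hN : IsGauge N) {A : E →ₗ[ℝ] F}
    (h : IsRotationInvariant N A 0) : ∃ c : ℝ, 0 ≤ c ∧ ∀ u, N u = c * ‖A u‖ := by
  rcases subsingleton_or_nontrivial E with hE | hE
  · exact ⟨0, le_rfl, fun u => by rw [Subsingleton.elim u 0, hN.zero, zero_mul]⟩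
  obtain ⟨w, hw⟩ := exists_ne (0 : E)
  have hAw : 0 < ‖A w‖ := norm_pos_iff.2 ((map_ne_zero_iff A h.injective).2 hw)
  refine ⟨N w / ‖A w‖, div_nonneg (hN.nonneg w) hAw.le, fun u => ?_⟩
  have h1 : N u = N ((‖A u‖ / ‖A w‖) • w) := by
    refine h.eq_of_eq _ _ ?_ rfl
    rw [map_smul, norm_smul, Real.norm_of_nonneg (by positivity), div_mul_cancel₀ _ hAw.ne']
  rw [h1, hN.smul, abs_of_nonneg (by positivity)]
  ring

theorem satisfiesParallelogram_of_eq_const_mul {N : E → ℝ} {A : E →ₗ[ℝ] F} {c : ℝ}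
    (h : ∀ u, N u = c * ‖A u‖) : SatisfiesParallelogram N := by
  intro u v
  have := parallelogram_law_with_norm ℝ (A u) (A v)
  simp only [h, map_add, map_sub]
  linear_combination c ^ 2 * this

/-- The Riesz representation of a linear form with respect to the inner product pulled back along
an injective linear map. -/
theorem exists_forall_eq_inner [FiniteDimensional ℝ E] {A : E →ₗ[ℝ] F}
    (hA : Function.Injective A) (ℓ : E →ₗ[ℝ] ℝ) : ∃ a : E, ∀ u, ℓ u = ⟪A a, A u⟫ := by
  let Φ : E →ₗ[ℝ] Module.Dual ℝ E := ((innerₗ F).compl₁₂ A A)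
  have hΦ : Function.Injective Φ := by
    refine (injective_iff_map_eq_zero Φ).2 fun u hu => ?_
    have h1 : ⟪A u, A u⟫ = 0 := by simpa [Φ] using LinearMap.congr_fun hu u
    exact (map_eq_zero_iff A hA).1 (inner_self_eq_zero.1 h1)
  have hs : Function.Surjective Φ :=
    (LinearMap.injective_iff_surjective_of_finrank_eq_finrank
      (Subspace.dual_finrank_eq (K := ℝ) (V := E)).symm).1 hΦ
  obtain ⟨a, ha⟩ := hs ℓ
  exact ⟨a, fun u => by rw [← ha]; simp [Φ]⟩

/-- Pythagoras for the decomposition of a vector along the axis `a` and the equator `ker ℓ`. -/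
theorem norm_sq_add_smul_of_inner_eq_zero {x y : F} (h : ⟪x, y⟫ = 0) (s t : ℝ) :
    ‖s • x + t • y‖ ^ 2 = s ^ 2 * ‖x‖ ^ 2 + t ^ 2 * ‖y‖ ^ 2 := by
  rw [norm_add_sq_real, inner_smul_left, inner_smul_right, h, norm_smul, norm_smul]
  simp [mul_pow]

/-- If a rotation invariant gauge satisfies the parallelogram identity on one plane spanned by the
axis and an equatorial vector, then it is Euclidean. -/
theorem IsRotationInvariant.exists_eq_norm {N : E → ℝ} (hN : IsGauge N) {A : E →ₗ[ℝ] F}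
    {ℓ : E →ₗ[ℝ] ℝ} (h : IsRotationInvariant N A ℓ) {a w : E} (ha : ∀ u, ℓ u = ⟪A a, A u⟫)
    (ha0 : a ≠ 0) (hw : ℓ w = 0) (hw0 : w ≠ 0)
    (hpar : ∀ s t : ℝ, N (s • a + t • w) ^ 2 + N (s • a - t • w) ^ 2 =
      2 * (N (s • a) ^ 2 + N (t • w) ^ 2)) :
    ∃ S : E →ₗ[ℝ] F, ∀ u, N u = ‖S u‖ := by
  have hAa : 0 < ‖A a‖ := norm_pos_iff.2 ((map_ne_zero_iff A h.injective).2 ha0)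
  have hAw : 0 < ‖A w‖ := norm_pos_iff.2 ((map_ne_zero_iff A h.injective).2 hw0)
  have hℓa : ℓ a = ‖A a‖ ^ 2 := by rw [ha, real_inner_self_eq_norm_sq]
  have hplane : ∀ s t : ℝ, N (s • a + t • w) ^ 2 = s ^ 2 * N a ^ 2 + t ^ 2 * N w ^ 2 := by
    intro s t
    have h1 : N (s • a - t • w) = N (s • a + t • w) := by
      refine h.eq_of_eq _ _ ?_ (by simp [hw])
      have h2 := norm_sq_add_smul_of_inner_eq_zero ((ha w).symm.trans hw) s t
      have h3 := norm_sq_add_smul_of_inner_eq_zero ((ha w).symm.trans hw) s (-t)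
      rw [← sq_eq_sq₀ (norm_nonneg _) (norm_nonneg _)]
      simp only [map_add, map_sub, map_smul]
      rw [h2, sub_eq_add_neg, ← neg_smul, h3]
      ring
    have h4 := hpar s t
    rw [h1, hN.smul, hN.smul, mul_pow, mul_pow, sq_abs, sq_abs] at h4
    linarith
  -- The coordinate of `u` along the axis is `ℓ u / ‖A a‖ ^ 2`, the rest of `u` is equatorial.
  let σ : E →ₗ[ℝ] ℝ := (‖A a‖ ^ 2)⁻¹ • ℓ
  let π : E →ₗ[ℝ] E := LinearMap.id - σ.smulRight a
  let S : E →ₗ[ℝ] F := σ.smulRight ((N a / ‖A a‖) • A a) + (N w / ‖A w‖) • (A ∘ₗ π)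
  have hσ : ∀ u, σ u * ‖A a‖ ^ 2 = ℓ u := fun u => by
    simp only [σ, LinearMap.smul_apply, smul_eq_mul]
    field_simp
  have hπ : ∀ u, ℓ (π u) = 0 := fun u => by
    simp only [π, LinearMap.sub_apply, LinearMap.id_apply, LinearMap.smulRight_apply, map_sub,
      map_smul, smul_eq_mul, hℓa, hσ, sub_self]
  have hdec : ∀ u, u = σ u • a + (1 : ℝ) • π u := fun u => by simp [π]
  refine ⟨S, fun u => ?_⟩
  have horth : ⟪A a, A (π u)⟫ = 0 := (ha _).symm.trans (hπ u)
  have hu : N u = N (σ u • a + (‖A (π u)‖ / ‖A w‖) • w) := by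
    refine h.eq_of_eq _ _ ?_ ?_
    · rw [← sq_eq_sq₀ (norm_nonneg _) (norm_nonneg _)]
      conv_lhs => rw [hdec u]
      simp only [map_add, map_smul]
      rw [norm_sq_add_smul_of_inner_eq_zero horth,
        norm_sq_add_smul_of_inner_eq_zero ((ha w).symm.trans hw)]
      field_simp
    · conv_lhs => rw [hdec u]
      simp [hw, hπ]
  rw [← sq_eq_sq₀ (hN.nonneg _) (norm_nonneg _), hu, hplane]
  have hS : S u = (σ u * (N a / ‖A a‖)) • A a + (N w / ‖A w‖) • A (π u) := by
    simp [S, mul_smul]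
  rw [hS, norm_sq_add_smul_of_inner_eq_zero horth]
  field_simp

end Abstract

/-! ### Uniqueness of the equator -/

section TwoAxes

open MeasureTheory Topology Filter

variable {E F G : Type*} [NormedAddCommGroup E] [InnerProductSpace ℝ E]
  [NormedAddCommGroup F] [InnerProductSpace ℝ F] [NormedAddCommGroup G] [InnerProductSpace ℝ G]

/-- The polar body of a gauge: the points whose support functional is dominated by `N`. -/
def polarBody (N : E → ℝ) : Set E := {y | ∀ u, ⟪y, u⟫ ≤ N u}

theorem isClosed_polarBody (N : E → ℝ) : IsClosed (polarBody N) := by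
  simp only [polarBody, Set.ofPred_forall]
  exact isClosed_iInter fun u => isClosed_le (by fun_prop) continuous_const

theorem IsGauge.exists_bounds [FiniteDimensional ℝ E] {N : E → ℝ} (hN : IsGauge N) :
    ∃ r R : ℝ, 0 < r ∧ 0 < R ∧ ∀ u, r * ‖u‖ ≤ N u ∧ N u ≤ R * ‖u‖ := by
  rcases subsingleton_or_nontrivial E with hE | hE
  · refine ⟨1, 1, one_pos, one_pos, fun u => ?_⟩
    rw [Subsingleton.elim u 0, hN.zero]; simp
  have hc : IsCompact (Metric.sphere (0 : E) 1) := isCompact_sphere _ _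
  have hne : (Metric.sphere (0 : E) 1).Nonempty := NormedSpace.sphere_nonempty.2 zero_le_one
  obtain ⟨x, hx, hmin⟩ := hc.exists_isMinOn hne hN.continuous.continuousOn
  obtain ⟨z, hz, hmax⟩ := hc.exists_isMaxOn hne hN.continuous.continuousOn
  refine ⟨N x, N z, hN.pos x (by rintro rfl; simp at hx),
    hN.pos z (by rintro rfl; simp at hz), fun u => ?_⟩
  rcases eq_or_ne u 0 with rfl | hu
  · simp [hN.zero]
  have hu' : 0 < ‖u‖ := norm_pos_iff.2 hu
  have hmem : ‖u‖⁻¹ • u ∈ Metric.sphere (0 : E) 1 := by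
    simp [norm_smul, hu'.ne']
  have h1 := hmin hmem
  have h2 := hmax hmem
  simp only [Set.mem_ofPred_eq, hN.smul, abs_inv, abs_norm] at h1 h2
  rw [inv_mul_eq_div] at h1 h2
  exact ⟨(le_div_iff₀ hu').1 h1, (div_le_iff₀ hu').1 h2⟩

theorem IsGauge.isCompact_polarBody [FiniteDimensional ℝ E] {N : E → ℝ} (hN : IsGauge N) :
    IsCompact (polarBody N) := by
  obtain ⟨r, R, -, hR, h⟩ := hN.exists_bounds
  refine (isCompact_closedBall (0 : E) R).of_isClosed_subset (isClosed_polarBody N) fun y hy => ?_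
  rw [mem_closedBall_zero_iff]
  rcases eq_or_ne y 0 with rfl | hy0
  · simpa using hR.le
  · have h1 := (hy y).trans (h y).2
    rw [real_inner_self_eq_norm_sq] at h1
    nlinarith [norm_pos_iff.2 hy0]

theorem IsGauge.exists_ball_subset_polarBody [FiniteDimensional ℝ E] {N : E → ℝ}
    (hN : IsGauge N) : ∃ r : ℝ, 0 < r ∧ Metric.ball 0 r ⊆ polarBody N := by
  obtain ⟨r, R, hr, -, h⟩ := hN.exists_bounds
  refine ⟨r, hr, fun y hy u => ?_⟩
  rw [mem_ball_zero_iff] at hy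
  calc ⟪y, u⟫ ≤ ‖y‖ * ‖u‖ := real_inner_le_norm y u
    _ ≤ r * ‖u‖ := by gcongr
    _ ≤ N u := (h u).1

/-- The adjoint of a linear automorphism of the gauge maps the polar body to itself and preserves
its volume: the determinant has absolute value one because that body has positive finite volume.
-/
theorem IsGauge.measurePreserving_adjoint [FiniteDimensional ℝ E] [MeasurableSpace E]
    [BorelSpace E] {N : E → ℝ} (hN : IsGauge N) (g : E →ₗ[ℝ] E) (hg : Function.Bijective g)
    (hgN : ∀ u, N (g u) = N u) :
    MeasurePreserving (LinearMap.adjoint g) (volume.restrict (polarBody N))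
      (volume.restrict (polarBody N)) := by
  set g' := LinearMap.adjoint g with hg'
  have hpre : g' ⁻¹' polarBody N = polarBody N := by
    ext y
    simp only [polarBody, Set.mem_preimage, Set.mem_ofPred_eq, hg', LinearMap.adjoint_inner_left]
    refine ⟨fun h u => ?_, fun h u => (h (g u)).trans (hgN u).le⟩
    obtain ⟨v, rfl⟩ := hg.2 u
    rw [hgN]; exact h v
  have hdet : LinearMap.det g' ≠ 0 := by
    have hinj : Function.Injective g' := by
      refine (injective_iff_map_eq_zero g').2 fun y hy => ?_
      obtain ⟨v, hv⟩ := hg.2 y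
      have := LinearMap.adjoint_inner_left g v y
      rw [← hg', hy, hv, inner_zero_left] at this
      exact inner_self_eq_zero.1 this.symm
    have hu : IsUnit g' := (LinearMap.isUnit_iff_ker_eq_bot g').2 (LinearMap.ker_eq_bot.2 hinj)
    exact (hu.map LinearMap.det).ne_zero
  have hcont : Continuous g' := LinearMap.continuous_of_finiteDimensional g'
  have hmap := Measure.map_linearMap_addHaar_eq_smul_addHaar (volume : Measure E) hdet
  have hpos : volume (polarBody N) ≠ 0 := by
    obtain ⟨r, hr, hsub⟩ := hN.exists_ball_subset_polarBody
    exact ((Metric.measure_ball_pos volume (0 : E) hr).trans_le (measure_mono hsub)).ne'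
  have hfin : volume (polarBody N) ≠ ⊤ := hN.isCompact_polarBody.measure_lt_top.ne
  have hone : ENNReal.ofReal |(LinearMap.det g')⁻¹| = 1 := by
    have h1 := congrArg (fun μ : Measure E => μ (polarBody N)) hmap
    simp only [Measure.smul_apply, smul_eq_mul] at h1
    rw [Measure.map_apply hcont.measurable (isClosed_polarBody N).measurableSet, hpre] at h1
    exact ((ENNReal.eq_div_iff hpos hfin).2 (by rw [mul_comm]; exact h1.symm)).trans
      (ENNReal.div_self hpos hfin)
  have hmp : MeasurePreserving g' (volume : Measure E) volume :=
    ⟨hcont.measurable, by rw [hmap, hone, one_smul]⟩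
  have := hmp.restrict_preimage (isClosed_polarBody N).measurableSet
  rwa [hpre] at this

/-- Every gauge has an invariant Euclidean structure: the `L²` norm of linear forms on the polar
body is preserved by all linear automorphisms that preserve the gauge. -/
theorem IsGauge.exists_invariant_norm [FiniteDimensional ℝ E] [MeasurableSpace E]
    [BorelSpace E] {N : E → ℝ} (hN : IsGauge N) :
    ∃ S : E →ₗ[ℝ] Lp ℝ 2 ((volume : Measure E).restrict (polarBody N)), Function.Injective S ∧
      ∀ g : E →ₗ[ℝ] E, Function.Bijective g → (∀ u, N (g u) = N u) → ∀ u, ‖S (g u)‖ = ‖S u‖ := by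
  set μ := (volume : Measure E).restrict (polarBody N) with hμ
  have hfin : IsFiniteMeasure μ := ⟨by
    rw [hμ, Measure.restrict_apply_univ]; exact hN.isCompact_polarBody.measure_lt_top⟩
  have hmem : ∀ u : E, MemLp (fun y => ⟪y, u⟫) 2 μ := by
    intro u
    obtain ⟨C, hC⟩ := hN.isCompact_polarBody.exists_bound_of_continuousOn
      (f := fun y : E => ⟪y, u⟫) (by fun_prop)
    refine MemLp.of_bound (by fun_prop) C ?_
    exact (ae_restrict_iff' (isClosed_polarBody N).measurableSet).2 (.of_forall hC)
  let S : E →ₗ[ℝ] Lp ℝ 2 μ :=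
    { toFun := fun u => (hmem u).toLp
      map_add' := fun u v => by
        rw [← MemLp.toLp_add]
        exact MemLp.toLp_congr _ _ (.of_forall fun y => inner_add_right _ _ _)
      map_smul' := fun t u => by
        rw [RingHom.id_apply, ← MemLp.toLp_const_smul]
        exact MemLp.toLp_congr _ _ (.of_forall fun y => by simp [inner_smul_right]) }
  refine ⟨S, (injective_iff_map_eq_zero S).2 fun u hu => ?_, fun g hg hgN u => ?_⟩
  · obtain ⟨r, hr, hsub⟩ := hN.exists_ball_subset_polarBody
    have h1 : (fun y : E => ⟪y, u⟫) =ᵐ[μ] 0 := (MemLp.toLp_eq_toLp_iff (hmem u)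
      (MemLp.zero : MemLp (0 : E → ℝ) 2 μ)).1 (by rw [MemLp.toLp_zero]; exact hu)
    have h2 : (fun y : E => ⟪y, u⟫) =ᵐ[volume.restrict (Metric.ball 0 r)] 0 :=
      ae_restrict_of_ae_restrict_of_subset hsub h1
    have h3 := Measure.eqOn_open_of_ae_eq h2 Metric.isOpen_ball
      (by fun_prop) continuousOn_const
    by_contra hu0
    have hu' : 0 < ‖u‖ := norm_pos_iff.2 hu0
    have h4 : (r / 2 / ‖u‖) • u ∈ Metric.ball (0 : E) r := by
      rw [mem_ball_zero_iff, norm_smul, Real.norm_of_nonneg (by positivity),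
        div_mul_cancel₀ _ hu'.ne']
      linarith
    have h5 := h3 h4
    simp only [inner_smul_left, Pi.zero_apply, mul_eq_zero, inner_self_eq_zero, hu0] at h5
    simp [hr.ne', hu'.ne'] at h5
  · have hcomp : (fun y : E => ⟪y, g u⟫) = (fun y : E => ⟪y, u⟫) ∘ LinearMap.adjoint g := by
      ext y; simp [LinearMap.adjoint_inner_left]
    change ‖(hmem (g u)).toLp‖ = ‖(hmem u).toLp‖
    rw [Lp.norm_toLp, Lp.norm_toLp, hcomp, eLpNorm_comp_measurePreserving
      (hmem u).1 (hN.measurePreserving_adjoint g hg hgN)]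

/-- The Euclidean structure in a rotation invariance can be replaced by any Euclidean structure that
is preserved by all automorphisms of the gauge: reflections in equatorial directions show
that the second one is a combination of the first one and the square of the linear form. -/
theorem IsRotationInvariant.of_invariant_norm [FiniteDimensional ℝ E] {N : E → ℝ}
    {A : E →ₗ[ℝ] F} {ℓ : E →ₗ[ℝ] ℝ} (h : IsRotationInvariant N A ℓ) (hℓ : ℓ ≠ 0)
    {S : E →ₗ[ℝ] G} (hS : Function.Injective S)
    (hinv : ∀ g : E →ₗ[ℝ] E, Function.Bijective g → (∀ u, N (g u) = N u) →
      ∀ u, ‖S (g u)‖ = ‖S u‖) :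
    IsRotationInvariant N S ℓ := by
  have key : ∀ u v, ‖A u‖ = ‖A v‖ → ℓ u = ℓ v → ‖S u‖ = ‖S v‖ := by
    intro u v huv hℓuv
    rcases eq_or_ne u v with rfl | hne
    · rfl
    set d := u - v with hd
    have hℓd : ℓ d = 0 := by simp [hd, hℓuv]
    have hAd : ‖A d‖ ^ 2 ≠ 0 := by
      have : A d ≠ 0 := (map_ne_zero_iff A h.injective).2 (sub_ne_zero.2 hne)
      positivity
    -- `g` is the reflection along `d` for the Euclidean structure of `A`; it maps `u` to `v`.
    let φ : E →ₗ[ℝ] ℝ := (2 / ‖A d‖ ^ 2) • ((innerₗ F (A d)) ∘ₗ A)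
    have hφ : ∀ w, φ w = 2 / ‖A d‖ ^ 2 * ⟪A d, A w⟫ := fun w => by simp [φ]
    let g : E →ₗ[ℝ] E := LinearMap.id - φ.smulRight d
    have hg : ∀ w, g w = w - φ w • d := fun w => by simp [g]
    have hφd : φ d = 2 := by rw [hφ, real_inner_self_eq_norm_sq, div_mul_cancel₀ _ hAd]
    have hgg : ∀ w, g (g w) = w := fun w => by
      rw [hg (g w), hg w, map_sub, map_smul, hφd, smul_eq_mul]
      module
    have hgN : ∀ w, N (g w) = N w := fun w => by
      refine h.eq_of_eq _ _ ?_ (by simp [hg, hℓd])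
      rw [← sq_eq_sq₀ (norm_nonneg _) (norm_nonneg _), hg, map_sub, map_smul, norm_sub_sq_real,
        inner_smul_right, norm_smul, mul_pow, Real.norm_eq_abs, sq_abs, hφ,
        real_inner_comm]
      field_simp
      ring
    have hgu : g u = v := by
      have : φ u = 1 := by
        rw [hφ, div_mul_eq_mul_div, div_eq_one_iff_eq hAd, hd, map_sub, inner_sub_left,
          norm_sub_sq_real, real_inner_self_eq_norm_sq, huv, real_inner_comm]
        ring
      rw [hg, this, one_smul, hd, sub_sub_cancel]
    rw [← hgu, hinv g (Function.Involutive.bijective hgg) hgN]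
  refine ⟨hS, fun u v huv hℓuv => h.eq_of_eq u v ?_ hℓuv⟩
  obtain ⟨a, ha⟩ := exists_forall_eq_inner h.injective ℓ
  have hℓa : ℓ a ≠ 0 := by
    intro h0
    refine hℓ (LinearMap.ext fun w => ?_)
    rw [ha, real_inner_self_eq_norm_sq, sq_eq_zero_iff, norm_eq_zero] at h0
    rw [ha, h0, inner_zero_left, LinearMap.zero_apply]
  -- On the equator, the second norm is a multiple of the first.
  have hK : IsRotationInvariant (fun u : LinearMap.ker ℓ => ‖S u‖) (A ∘ₗ (LinearMap.ker ℓ).subtype)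
      0 := ⟨h.injective.comp Subtype.val_injective, fun m m' hm _ =>
        key m m' hm (by rw [m.2, m'.2])⟩
  obtain ⟨c, -, hc⟩ := hK.eq_const_mul
    (isGauge_norm_comp (S ∘ₗ (LinearMap.ker ℓ).subtype) (hS.comp Subtype.val_injective))
  have hc' : ∀ m, ℓ m = 0 → ‖S m‖ = c * ‖A m‖ := fun m hm => hc ⟨m, hm⟩
  set s := ℓ u / ℓ a with hs
  have hA : ∀ m, ℓ m = 0 → ‖A (s • a + m)‖ ^ 2 = s ^ 2 * ‖A a‖ ^ 2 + ‖A m‖ ^ 2 := fun m hm => by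
    simpa using norm_sq_add_smul_of_inner_eq_zero ((ha m).symm.trans hm) s 1
  have hSm : ∀ m, ℓ m = 0 → ‖S (s • a + m)‖ ^ 2 = s ^ 2 * ‖S a‖ ^ 2 + ‖S m‖ ^ 2 := fun m hm => by
    have h1 : ‖S (s • a + m)‖ = ‖S (s • a + -m)‖ := by
      refine key _ _ ?_ (by simp [hm])
      rw [← sq_eq_sq₀ (norm_nonneg _) (norm_nonneg _), hA m hm, hA (-m) (by simp [hm]), map_neg,
        norm_neg]
    have h2 := parallelogram_law_with_norm ℝ (S (s • a)) (S m)
    rw [← map_add, ← map_sub, sub_eq_add_neg (s • a) m, ← h1, map_smul, norm_smul,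
      Real.norm_eq_abs] at h2
    nlinarith [sq_abs s]
  have hmu : ℓ (u - s • a) = 0 := by simp [hs, hℓa]
  have hmv : ℓ (v - s • a) = 0 := by simp [hs, hℓa, hℓuv]
  have h1 := hSm _ hmu
  have h2 := hSm _ hmv
  have h3 := hA _ hmu
  have h4 := hA _ hmv
  rw [add_sub_cancel] at h1 h2 h3 h4
  have h5 : ‖S (u - s • a)‖ ^ 2 = ‖S (v - s • a)‖ ^ 2 := by rw [huv] at h1; linarith
  have h6 : ‖A (u - s • a)‖ ^ 2 = ‖A (v - s • a)‖ ^ 2 := by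
    by_cases hc0 : c = 0
    · have hz : ∀ m, ℓ m = 0 → m = 0 := fun m hm => by
        have := hc' m hm
        rw [hc0, zero_mul, norm_eq_zero] at this
        exact (map_eq_zero_iff S hS).1 this
      rw [hz _ hmu, hz _ hmv]
    · rw [hc' _ hmu, hc' _ hmv, mul_pow, mul_pow] at h5
      exact mul_left_cancel₀ (pow_ne_zero 2 hc0) h5
  rw [← sq_eq_sq₀ (norm_nonneg _) (norm_nonneg _), h3, h4, h6]

/-- Two distinct axes with respect to the same Euclidean structure: starting from height `s` over
the first equator, alternately passing to a point over the axis and using the other axis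
multiplies the height by the cosine `c` of the angle between the axes, so that in the limit
every unit vector is equivalent to a common vector `k` orthogonal to both axes. -/
theorem eq_const_mul_of_two_axes [FiniteDimensional ℝ E] (hdim : 3 ≤ Module.finrank ℝ E)
    {N : E → ℝ} (hN : IsGauge N) {S : E →ₗ[ℝ] G} {ℓ₁ ℓ₂ : E →ₗ[ℝ] ℝ}
    (h₁ : IsRotationInvariant N S ℓ₁) (h₂ : IsRotationInvariant N S ℓ₂)
    (hind : LinearIndependent ℝ ![ℓ₁, ℓ₂]) : ∃ c : ℝ, ∀ u, N u = c * ‖S u‖ := by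
  have hS := h₁.injective
  obtain ⟨e, he⟩ := exists_forall_eq_inner hS ℓ₁
  obtain ⟨f, hf⟩ := exists_forall_eq_inner hS ℓ₂
  have hlin : ∀ s t : ℝ, s • e + t • f = 0 → s = 0 ∧ t = 0 := by
    intro s t hst
    refine LinearIndependent.pair_iff.1 hind s t (LinearMap.ext fun u => ?_)
    have : ⟪S (s • e + t • f), S u⟫ = 0 := by simp [hst]
    simpa [inner_add_left, inner_smul_left, he, hf] using this
  have he0 : S e ≠ 0 := (map_ne_zero_iff S hS).2 fun h => by
    have := hlin 1 0 (by simp [h]); simp at this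
  have hf0 : S f ≠ 0 := (map_ne_zero_iff S hS).2 fun h => by
    have := hlin 0 1 (by simp [h]); simp at this
  have hen : 0 < ‖S e‖ := norm_pos_iff.2 he0
  have hfn : 0 < ‖S f‖ := norm_pos_iff.2 hf0
  obtain ⟨k, hk1, hk2, hk⟩ : ∃ k, ⟪S e, S k⟫ = 0 ∧ ⟪S f, S k⟫ = 0 ∧ ‖S k‖ = 1 := by
    have : ∃ k ≠ 0, (ℓ₁.prod ℓ₂) k = 0 := by
      have hker : LinearMap.ker (ℓ₁.prod ℓ₂) ≠ ⊥ := LinearMap.ker_ne_bot_of_finrank_lt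
        (by simp; omega)
      obtain ⟨k, hk, hk0⟩ := Submodule.exists_mem_ne_zero_of_ne_bot hker
      exact ⟨k, hk0, hk⟩
    obtain ⟨k, hk0, hk⟩ := this
    replace hk : ℓ₁ k = 0 ∧ ℓ₂ k = 0 := Prod.mk_eq_zero.1 hk
    have hSk : 0 < ‖S k‖ := norm_pos_iff.2 ((map_ne_zero_iff S hS).2 hk0)
    refine ⟨‖S k‖⁻¹ • k, ?_, ?_, ?_⟩
    · rw [map_smul, inner_smul_right, ← he, hk.1, mul_zero]
    · rw [map_smul, inner_smul_right, ← hf, hk.2, mul_zero]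
    · rw [map_smul, norm_smul, norm_inv, norm_norm, inv_mul_cancel₀ hSk.ne']
  set e' := ‖S e‖⁻¹ • e with he'
  set f' := ‖S f‖⁻¹ • f with hf'
  have hne' : ‖S e'‖ = 1 := by
    rw [he', map_smul, norm_smul, norm_inv, norm_norm, inv_mul_cancel₀ hen.ne']
  have hnf' : ‖S f'‖ = 1 := by
    rw [hf', map_smul, norm_smul, norm_inv, norm_norm, inv_mul_cancel₀ hfn.ne']
  have hke : ⟪S e', S k⟫ = 0 := by rw [he', map_smul, inner_smul_left, hk1, mul_zero]
  have hkf : ⟪S f', S k⟫ = 0 := by rw [hf', map_smul, inner_smul_left, hk2, mul_zero]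
  have he1 : ∀ u v, ‖S u‖ = ‖S v‖ → ⟪S e', S u⟫ = ⟪S e', S v⟫ → N u = N v := by
    intro u v h1 h2
    refine h₁.eq_of_eq u v h1 ?_
    rw [he, he]
    simpa [he', inner_smul_left, hen.ne'] using h2
  have hf1 : ∀ u v, ‖S u‖ = ‖S v‖ → ⟪S f', S u⟫ = ⟪S f', S v⟫ → N u = N v := by
    intro u v h1 h2
    refine h₂.eq_of_eq u v h1 ?_
    rw [hf, hf]
    simpa [hf', inner_smul_left, hfn.ne'] using h2
  set c := ⟪S e', S f'⟫ with hcdef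
  have hc : |c| < 1 := by
    have hle : |c| ≤ 1 := by simpa [hne', hnf'] using abs_real_inner_le_norm (S e') (S f')
    refine lt_of_le_of_ne hle fun hc1 => ?_
    have hfc : ‖S f' - c • S e'‖ ^ 2 = 0 := by
      rw [norm_sub_sq_real, inner_smul_right, norm_smul, real_inner_comm, ← hcdef, hne', hnf',
        Real.norm_eq_abs, hc1]
      nlinarith [sq_abs c]
    rw [sq_eq_zero_iff, norm_eq_zero, ← map_smul, ← map_sub, map_eq_zero_iff S hS] at hfc
    have := (hlin (-(c * ‖S e‖⁻¹)) (‖S f‖⁻¹) (by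
      rw [← hfc, he', hf']; module)).2
    exact hfn.ne' (inv_eq_zero.1 this)
  let w : E → ℝ → E := fun x s => s • x + √(1 - s ^ 2) • k
  have hw : ∀ x s, ‖S x‖ = 1 → ⟪S x, S k⟫ = 0 → |s| ≤ 1 → ‖S (w x s)‖ = 1 := by
    intro x s hx hxk hs
    rw [← sq_eq_sq₀ (norm_nonneg _) zero_le_one]
    simp only [w, map_add, map_smul]
    have : s ^ 2 ≤ 1 := (sq_le_one_iff_abs_le_one s).2 hs
    rw [norm_sq_add_smul_of_inner_eq_zero hxk, hx, hk, Real.sq_sqrt (by linarith)]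
    ring
  have hcs : ∀ s, |s| ≤ 1 → |c * s| ≤ 1 := fun s hs => by
    rw [abs_mul]; exact mul_le_one₀ hc.le (abs_nonneg _) hs
  have hstep1 : ∀ s, |s| ≤ 1 → N (w e' s) = N (w f' (c * s)) := fun s hs => by
    refine hf1 _ _ (by rw [hw _ _ hne' hke hs, hw _ _ hnf' hkf (hcs s hs)]) ?_
    simp only [w, map_add, map_smul, inner_add_right, inner_smul_right, hkf,
      real_inner_self_eq_norm_sq, hnf']
    rw [real_inner_comm, ← hcdef]
    ring
  have hstep2 : ∀ s, |s| ≤ 1 → N (w f' s) = N (w e' (c * s)) := fun s hs => by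
    refine he1 _ _ (by rw [hw _ _ hnf' hkf hs, hw _ _ hne' hke (hcs s hs)]) ?_
    simp only [w, map_add, map_smul, inner_add_right, inner_smul_right, hke,
      real_inner_self_eq_norm_sq, hne']
    rw [← hcdef]
    ring
  have hiter : ∀ s, |s| ≤ 1 → N (w e' s) = N k := by
    intro s hs
    have hbd : ∀ j : ℕ, |(c * c) ^ j * s| ≤ 1 := fun j => by
      rw [abs_mul, abs_pow, abs_mul]
      exact mul_le_one₀ (pow_le_one₀ (by positivity) (mul_le_one₀ hc.le (abs_nonneg _) hc.le))
        (abs_nonneg _) hs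
    have hconst : ∀ j : ℕ, N (w e' ((c * c) ^ j * s)) = N (w e' s) := by
      intro j
      induction j with
      | zero => simp
      | succ j ih =>
        rw [← ih, hstep1 _ (hbd j), hstep2 _ (hcs _ (hbd j))]
        congr 2
        ring
    have hlim : Tendsto (fun j : ℕ => N (w e' ((c * c) ^ j * s))) atTop (𝓝 (N (w e' 0))) := by
      have hcont : Continuous fun s => N (w e' s) := hN.continuous.comp (by fun_prop)
      have hz : Tendsto (fun j : ℕ => (c * c) ^ j * s) atTop (𝓝 0) := by
        have : Tendsto (fun j : ℕ => (c * c) ^ j) atTop (𝓝 0) := by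
          refine tendsto_pow_atTop_nhds_zero_of_abs_lt_one ?_
          rw [abs_mul]
          nlinarith [abs_nonneg c]
        simpa using this.mul_const s
      exact (hcont.tendsto 0).comp hz
    simp only [hconst] at hlim
    rw [tendsto_nhds_unique tendsto_const_nhds hlim]
    simp [w]
  refine ⟨N k, fun u => ?_⟩
  rcases eq_or_ne u 0 with rfl | hu
  · simp [hN.zero]
  have hSu : 0 < ‖S u‖ := norm_pos_iff.2 ((map_ne_zero_iff S hS).2 hu)
  set v := ‖S u‖⁻¹ • u with hv
  have hSv : ‖S v‖ = 1 := by
    rw [hv, map_smul, norm_smul, norm_inv, norm_norm, inv_mul_cancel₀ hSu.ne']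
  have huv : u = ‖S u‖ • v := by rw [hv, smul_smul, mul_inv_cancel₀ hSu.ne', one_smul]
  have hs : |⟪S e', S v⟫| ≤ 1 := by simpa [hne', hSv] using abs_real_inner_le_norm (S e') (S v)
  have hNv : N v = N k := by
    rw [← hiter _ hs]
    refine he1 _ _ (by rw [hSv, hw _ _ hne' hke hs]) ?_
    simp only [w, map_add, map_smul, inner_add_right, inner_smul_right, hke,
      real_inner_self_eq_norm_sq, hne']
    ring
  conv_lhs => rw [huv, hN.smul, abs_norm, hNv]
  ring

/-- In dimension at least three, a gauge with two different equators is Euclidean. -/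
theorem satisfiesParallelogram_of_linearIndependent [FiniteDimensional ℝ E]
    (hdim : 3 ≤ Module.finrank ℝ E) {N : E → ℝ} (hN : IsGauge N) {A₁ : E →ₗ[ℝ] F}
    {A₂ : E →ₗ[ℝ] G} {ℓ₁ ℓ₂ : E →ₗ[ℝ] ℝ} (h₁ : IsRotationInvariant N A₁ ℓ₁)
    (h₂ : IsRotationInvariant N A₂ ℓ₂) (hind : LinearIndependent ℝ ![ℓ₁, ℓ₂]) :
    SatisfiesParallelogram N := by
  borelize E
  obtain ⟨S, hS, hinv⟩ := hN.exists_invariant_norm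
  have hℓ₁ : ℓ₁ ≠ 0 := hind.ne_zero 0
  have hℓ₂ : ℓ₂ ≠ 0 := hind.ne_zero 1
  obtain ⟨c, hc⟩ := eq_const_mul_of_two_axes hdim hN (h₁.of_invariant_norm hℓ₁ hS hinv)
    (h₂.of_invariant_norm hℓ₂ hS hinv) hind
  exact satisfiesParallelogram_of_eq_const_mul hc

end TwoAxes

/-! ### Families of planes and the Euclidean hyperplane -/

section Planes

/-- A plane meets a subspace that does not contain it in at most a line. -/
theorem exists_eq_smul_of_finrank_le_two {V : Type*} [AddCommGroup V] [Module ℝ V]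
    [FiniteDimensional ℝ V] {P T : Submodule ℝ V} (hP : Module.finrank ℝ P ≤ 2) {x w z : V}
    (hx : x ∈ P) (hxT : x ∉ T) (hw : w ∈ P) (hwT : w ∈ T) (hw0 : w ≠ 0) (hz : z ∈ P)
    (hzT : z ∈ T) : ∃ r : ℝ, z = r • w := by
  have hlt : P ⊓ T < P := lt_of_le_of_ne inf_le_left fun h => hxT (inf_eq_left.1 h hx)
  have h1 := Submodule.finrank_lt_finrank_of_lt hlt
  let w' : (P ⊓ T : Submodule ℝ V) := ⟨w, hw, hwT⟩
  have hw' : w' ≠ 0 := fun h => hw0 (congrArg Subtype.val h)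
  have h2 : Module.finrank ℝ (P ⊓ T : Submodule ℝ V) = 1 := by
    have : 0 < Module.finrank ℝ (P ⊓ T : Submodule ℝ V) :=
      Module.finrank_pos_iff_exists_ne_zero.2 ⟨w', hw'⟩
    omega
  obtain ⟨r, hr⟩ := (finrank_eq_one_iff_of_nonzero' w' hw').1 h2 ⟨z, hz, hzT⟩
  exact ⟨r, (congrArg Subtype.val hr).symm⟩

theorem exists_notMem_of_ne_top {V : Type*} [AddCommGroup V] [Module ℝ V] (T : Submodule ℝ V)
    (hT : T ≠ ⊤) : ∃ x, x ∉ T := by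
  simpa [Submodule.eq_top_iff'] using hT

theorem exists_notMem_notMem {V : Type*} [AddCommGroup V] [Module ℝ V] {P T : Submodule ℝ V}
    (hP : P ≠ ⊤) (hT : T ≠ ⊤) : ∃ x, x ∉ P ∧ x ∉ T := by
  obtain ⟨a, ha⟩ := exists_notMem_of_ne_top P hP
  obtain ⟨b, hb⟩ := exists_notMem_of_ne_top T hT
  by_cases haT : a ∈ T
  · by_cases hbP : b ∈ P
    · exact ⟨a + b, fun h => ha ((P.add_mem_iff_left hbP).1 h),
        fun h => hb ((T.add_mem_iff_right haT).1 h)⟩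
    · exact ⟨b, hbP, hb⟩
  · exact ⟨a, ha, haT⟩

/-- Pairwise intersecting planes `P x ∋ x`, one for each nonzero vector, have a common line. They do
not all lie in one three-dimensional space, which is the other way for planes to intersect
pairwise. -/
theorem exists_common_vector {V : Type*} [AddCommGroup V] [Module ℝ V] [FiniteDimensional ℝ V]
    (hV : 4 ≤ Module.finrank ℝ V) (P : V → Submodule ℝ V)
    (hdim : ∀ x, Module.finrank ℝ (P x) ≤ 2) (hmem : ∀ x, x ∈ P x)
    (hmeet : ∀ x y, x ≠ 0 → y ≠ 0 → ∃ w, w ≠ 0 ∧ w ∈ P x ∧ w ∈ P y) :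
    ∃ z, z ≠ 0 ∧ ∀ x, x ≠ 0 → z ∈ P x := by
  have hproper : ∀ T : Submodule ℝ V, Module.finrank ℝ T ≤ 3 → T ≠ ⊤ := by
    rintro T hT rfl
    rw [finrank_top] at hT
    omega
  have : Nontrivial V := Module.nontrivial_of_finrank_pos (R := ℝ) (by omega)
  obtain ⟨x₁, hx₁⟩ := exists_ne (0 : V)
  obtain ⟨x₂, hx₂⟩ := exists_notMem_of_ne_top (P x₁)
    (hproper _ ((hdim x₁).trans (by norm_num)))
  have hx₂0 : x₂ ≠ 0 := fun h => hx₂ (h ▸ (P x₁).zero_mem)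
  obtain ⟨z, hz0, hz₁, hz₂⟩ := hmeet x₁ x₂ hx₁ hx₂0
  set T := P x₁ ⊔ P x₂ with hT
  have hTdim : Module.finrank ℝ T ≤ 3 := by
    have h1 := Submodule.finrank_sup_add_finrank_inf_eq (P x₁) (P x₂)
    have h2 : 0 < Module.finrank ℝ (P x₁ ⊓ P x₂ : Submodule ℝ V) :=
      Module.finrank_pos_iff_exists_ne_zero.2
        ⟨⟨z, hz₁, hz₂⟩, fun h => hz0 (congrArg Subtype.val h)⟩
    have := hdim x₁
    have := hdim x₂
    rw [← hT] at h1
    omega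
  have hout : ∀ x, x ∉ T → z ∈ P x := by
    intro x hx
    have hx0 : x ≠ 0 := fun h => hx (h ▸ T.zero_mem)
    obtain ⟨w₁, hw₁0, hw₁, hw₁x⟩ := hmeet x₁ x hx₁ hx0
    obtain ⟨w₂, hw₂0, hw₂, hw₂x⟩ := hmeet x₂ x hx₂0 hx0
    obtain ⟨r, hr⟩ := exists_eq_smul_of_finrank_le_two (hdim x) (hmem x) hx hw₂x
      ((le_sup_right : P x₂ ≤ T) hw₂) hw₂0 hw₁x ((le_sup_left : P x₁ ≤ T) hw₁)
    have hw₁₂ : w₁ ∈ P x₂ := hr ▸ (P x₂).smul_mem r hw₂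
    obtain ⟨q, hq⟩ := exists_eq_smul_of_finrank_le_two (hdim x₂) (hmem x₂) hx₂ hw₁₂ hw₁ hw₁0
      hz₂ hz₁
    exact hq ▸ (P x).smul_mem q hw₁x
  refine ⟨z, hz0, fun x hx0 => ?_⟩
  set Q := P x ⊔ Submodule.span ℝ {z} with hQ
  have hQdim : Module.finrank ℝ Q ≤ 3 := by
    have h1 := Submodule.finrank_add_le_finrank_add_finrank (P x) (Submodule.span ℝ {z})
    rw [finrank_span_singleton hz0] at h1
    exact h1.trans (by have := hdim x; omega)
  obtain ⟨y, hyT, hyQ⟩ := exists_notMem_notMem (hproper T hTdim) (hproper Q hQdim)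
  have hy0 : y ≠ 0 := fun h => hyT (h ▸ T.zero_mem)
  obtain ⟨w, hw0, hwx, hwy⟩ := hmeet x y hx0 hy0
  obtain ⟨r, hr⟩ := exists_eq_smul_of_finrank_le_two (hdim y) (hmem y) hyQ hwy
    ((le_sup_left : P x ≤ Q) hwx) hw0 (hout y hyT)
    ((le_sup_right : _ ≤ Q) (Submodule.mem_span_singleton_self z))
  exact hr ▸ (P x).smul_mem r hwx

end Planes

section Gauge

open Topology Filter

variable {V : Type*} [NormedAddCommGroup V] [InnerProductSpace ℝ V]

theorem exists_ne_zero_forall_inner_eq_zero [FiniteDimensional ℝ V] (s : Finset V)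
    (hs : s.card < Module.finrank ℝ V) :
    ∃ w : V, w ≠ 0 ∧ ∀ x ∈ s, ⟪x, w⟫ = 0 := by
  have h1 : Module.finrank ℝ (Submodule.span ℝ (s : Set V)) < Module.finrank ℝ V :=
    (finrank_span_finset_le_card s).trans_lt hs
  have h2 := (Submodule.span ℝ (s : Set V)).finrank_add_finrank_orthogonal
  have h3 : (Submodule.span ℝ (s : Set V))ᗮ ≠ ⊥ := by
    intro h
    rw [h, finrank_bot] at h2
    omega
  obtain ⟨w, hw, hw0⟩ := Submodule.exists_mem_ne_zero_of_ne_bot h3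
  exact ⟨w, hw0, fun x hx => hw x (Submodule.subset_span hx)⟩

theorem mem_orthogonal_span_pair {x y u : V} :
    u ∈ (Submodule.span ℝ {x, y})ᗮ ↔ ⟪x, u⟫ = 0 ∧ ⟪y, u⟫ = 0 := by
  refine ⟨fun h => ⟨h x (Submodule.subset_span (by simp)), h y (Submodule.subset_span (by simp))⟩,
    fun h w hw => ?_⟩
  obtain ⟨s, t, rfl⟩ := Submodule.mem_span_pair.1 hw
  simp [inner_add_left, inner_smul_left, h.1, h.2]

theorem finrank_span_pair_le (x y : V) : Module.finrank ℝ (Submodule.span ℝ {x, y}) ≤ 2 := by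
  classical
  have h := finrank_span_finset_le_card (R := ℝ) ({x, y} : Finset V)
  rw [Finset.coe_pair] at h
  exact h.trans Finset.card_le_two

/-- The parallelogram identity fails for two vectors orthogonal to both `x` and `y`, so `N` is not
Euclidean on the codimension two section orthogonal to `x` and `y`. -/
def FailsOnOrthogonal (N : V → ℝ) (x y : V) : Prop :=
  ∃ u v : V, ⟪x, u⟫ = 0 ∧ ⟪y, u⟫ = 0 ∧ ⟪x, v⟫ = 0 ∧ ⟪y, v⟫ = 0 ∧
    N (u + v) ^ 2 + N (u - v) ^ 2 - 2 * (N u ^ 2 + N v ^ 2) ≠ 0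

theorem IsGauge.eventually_failsOnOrthogonal {N : V → ℝ} (hN : IsGauge N) {x₀ y : V}
    (hx₀ : x₀ ≠ 0) (hxy : ⟪y, x₀⟫ = 0) (h : FailsOnOrthogonal N x₀ y) :
    ∀ᶠ x in 𝓝 x₀, FailsOnOrthogonal N x y := by
  obtain ⟨u, v, hxu, hyu, hxv, hyv, hd⟩ := h
  -- This shear moves a vector orthogonal to `y` to one orthogonal to both `x` and `y`.
  let T : V → V → V := fun x u => ⟪x, x₀⟫ • u - ⟪x, u⟫ • x₀
  have hT : ∀ x u, ⟪x, T x u⟫ = 0 := fun x u => by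
    simp only [T, inner_sub_right, inner_smul_right]; ring
  have hTy : ∀ x u, ⟪y, u⟫ = 0 → ⟪y, T x u⟫ = 0 := fun x u hu => by
    simp [T, inner_sub_right, inner_smul_right, hu, hxy]
  have hcont : Continuous fun x => N (T x u + T x v) ^ 2 + N (T x u - T x v) ^ 2 -
      2 * (N (T x u) ^ 2 + N (T x v) ^ 2) := by
    have := hN.continuous
    fun_prop
  have h0 : N (T x₀ u + T x₀ v) ^ 2 + N (T x₀ u - T x₀ v) ^ 2 -
      2 * (N (T x₀ u) ^ 2 + N (T x₀ v) ^ 2) ≠ 0 := by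
    have h1 : ∀ u, ⟪x₀, u⟫ = 0 → T x₀ u = ‖x₀‖ ^ 2 • u := fun u hu => by
      simp only [T, hu, real_inner_self_eq_norm_sq, zero_smul, sub_zero]
    rw [h1 u hxu, h1 v hxv, ← smul_add, ← smul_sub]
    simp only [hN.smul]
    have h2 : (|‖x₀‖ ^ 2| ^ 2 : ℝ) ≠ 0 := by
      have := norm_pos_iff.2 hx₀
      positivity
    convert mul_ne_zero h2 hd using 1
    ring
  filter_upwards [hcont.continuousAt.eventually_ne h0] with x hx
  exact ⟨T x u, T x v, hT x u, hTy x u hyu, hT x v, hTy x v hyv, hx⟩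

/-- A gauge on a space of dimension at least five whose restriction to each hyperplane is invariant
under affine rotations is Euclidean on some hyperplane. -/
theorem IsGauge.exists_euclidean_hyperplane [FiniteDimensional ℝ V]
    (hV : 5 ≤ Module.finrank ℝ V) {N : V → ℝ} (hN : IsGauge N)
    (hrot : ∀ x : V, x ≠ 0 → ∃ (A : (Submodule.span ℝ {x})ᗮ →ₗ[ℝ] (Submodule.span ℝ {x})ᗮ) (p : V),
      IsRotationInvariant (N ∘ Subtype.val) A (innerₗ V p ∘ₗ (Submodule.span ℝ {x})ᗮ.subtype)) :
    ∃ x : V, x ≠ 0 ∧ ∃ S : (Submodule.span ℝ {x})ᗮ →ₗ[ℝ] (Submodule.span ℝ {x})ᗮ,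
      ∀ u : (Submodule.span ℝ {x})ᗮ, N u = ‖S u‖ := by
  classical
  by_contra! hno
  have hrot' : ∀ x : V, ∃ (A : (Submodule.span ℝ {x})ᗮ →ₗ[ℝ] (Submodule.span ℝ {x})ᗮ) (p : V),
      x ≠ 0 → IsRotationInvariant (N ∘ Subtype.val) A
        (innerₗ V p ∘ₗ (Submodule.span ℝ {x})ᗮ.subtype) := by
    intro x
    by_cases hx : x = 0
    · exact ⟨0, 0, fun h => (h hx).elim⟩
    · obtain ⟨A, p, h⟩ := hrot x hx
      exact ⟨A, p, fun _ => h⟩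
  choose A p hA using hrot'
  have hgauge : ∀ W : Submodule ℝ V, IsGauge (N ∘ (Subtype.val : W → V)) := fun W =>
    hN.comp W.subtypeL Subtype.val_injective
  -- A hyperplane without equator would be Euclidean.
  have hℓ : ∀ x, x ≠ 0 → innerₗ V (p x) ∘ₗ (Submodule.span ℝ {x})ᗮ.subtype ≠ 0 := by
    intro x hx h0
    have h1 := hA x hx
    rw [h0] at h1
    obtain ⟨c, hc0, hc⟩ := h1.eq_const_mul (hgauge _)
    obtain ⟨u, hu⟩ := hno x hx (c • A x)
    exact hu (by rw [LinearMap.smul_apply, norm_smul, Real.norm_of_nonneg hc0]; exact hc u)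
  have hp : ∀ x, x ≠ 0 → ∀ s t : ℝ, s • p x = t • x → s = 0 := by
    intro x hx s t hst
    by_contra hs
    refine hℓ x hx (LinearMap.ext fun u => ?_)
    have h1 : ⟪x, (u : V)⟫ = 0 := Submodule.mem_orthogonal_singleton_iff_inner_right.1 u.2
    have h2 : s * ⟪p x, (u : V)⟫ = 0 := by
      rw [← real_inner_smul_left, hst, real_inner_smul_left, h1, mul_zero]
    simpa [hs] using h2
  have haxis : ∀ x, ∃ a : (Submodule.span ℝ {x})ᗮ, x ≠ 0 → a ≠ 0 ∧
      ∀ u : (Submodule.span ℝ {x})ᗮ, ⟪p x, (u : V)⟫ = ⟪A x a, A x u⟫ := by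
    intro x
    by_cases hx : x = 0
    · exact ⟨0, fun h => (h hx).elim⟩
    obtain ⟨a, ha⟩ := exists_forall_eq_inner (hA x hx).injective
      (innerₗ V (p x) ∘ₗ (Submodule.span ℝ {x})ᗮ.subtype)
    refine ⟨a, fun _ => ⟨?_, fun u => ha u⟩⟩
    rintro rfl
    exact hℓ x hx (LinearMap.ext fun u => by rw [ha]; simp)
  choose a ha using haxis
  -- A section containing the axis is not Euclidean.
  have hfails : ∀ x y, y ≠ 0 → ⟪x, (a y : V)⟫ = 0 → FailsOnOrthogonal N x y := by
    intro x y hy hxa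
    by_contra hcon
    obtain ⟨w, hw0, hw⟩ := exists_ne_zero_forall_inner_eq_zero {x, y, p y}
      (Finset.card_le_three.trans_lt (by omega))
    have hya : ⟪y, (a y : V)⟫ = 0 :=
      Submodule.mem_orthogonal_singleton_iff_inner_right.1 (a y).2
    have hyw : ⟪y, w⟫ = 0 := hw y (by simp)
    have hxw : ⟪x, w⟫ = 0 := hw x (by simp)
    obtain ⟨S, hS⟩ := (hA y hy).exists_eq_norm (hgauge _) (a := a y)
      (w := ⟨w, Submodule.mem_orthogonal_singleton_iff_inner_right.2 hyw⟩)
      (ha y hy).2 (ha y hy).1 (hw (p y) (by simp)) (fun h => hw0 (congrArg Subtype.val h))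
      (fun s t => by
        by_contra hne
        refine hcon ⟨s • (a y : V), t • w, ?_, ?_, ?_, ?_, sub_ne_zero.2 hne⟩ <;>
          simp [inner_smul_right, hxa, hya, hyw, hxw])
    obtain ⟨u, hu⟩ := hno y hy S
    exact hu (hS u)
  let P : V → Submodule ℝ V := fun x => Submodule.span ℝ {x, p x}
  -- Uniqueness of the equator of a non-Euclidean section.
  have hmeet' : ∀ x y, x ≠ 0 → y ≠ 0 → FailsOnOrthogonal N x y →
      ∃ w, w ≠ 0 ∧ w ∈ P x ∧ w ∈ P y := by
    rintro x y hx hy ⟨u, v, hxu, hyu, hxv, hyv, hd⟩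
    set W := (Submodule.span ℝ {x, y})ᗮ with hW
    have hWdim : 3 ≤ Module.finrank ℝ W := by
      have h1 := (Submodule.span ℝ {x, y}).finrank_add_finrank_orthogonal
      have h2 := finrank_span_pair_le x y
      rw [← hW] at h1
      omega
    have hWx : W ≤ (Submodule.span ℝ {x})ᗮ := Submodule.orthogonal_le
      (Submodule.span_mono (by simp))
    have hWy : W ≤ (Submodule.span ℝ {y})ᗮ := Submodule.orthogonal_le
      (Submodule.span_mono (by simp))
    have h1 := (hA x hx).comp (Submodule.inclusion hWx) (Submodule.inclusion_injective hWx)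
    have h2 := (hA y hy).comp (Submodule.inclusion hWy) (Submodule.inclusion_injective hWy)
    have hdep := mt (satisfiesParallelogram_of_linearIndependent hWdim (hgauge W) h1 h2)
      fun hpar => hd (sub_eq_zero.2 (hpar ⟨u, mem_orthogonal_span_pair.2 ⟨hxu, hyu⟩⟩
        ⟨v, mem_orthogonal_span_pair.2 ⟨hxv, hyv⟩⟩))
    rw [LinearIndependent.pair_iff] at hdep
    push Not at hdep
    obtain ⟨s, t, hst, hst0⟩ := hdep
    have hmem : s • p x + t • p y ∈ Submodule.span ℝ {x, y} := by
      rw [← Submodule.orthogonal_orthogonal (Submodule.span ℝ {x, y})]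
      intro m hm
      have := LinearMap.congr_fun hst (⟨m, hm⟩ : W)
      rw [real_inner_comm, inner_add_left, real_inner_smul_left, real_inner_smul_left]
      exact this
    obtain ⟨α, β, hαβ⟩ := Submodule.mem_span_pair.1 hmem
    refine ⟨s • p x - α • x, fun h0 => ?_, ?_, ?_⟩
    · have hs : s = 0 := hp x hx s α (sub_eq_zero.1 h0)
      refine hst0 hs (hp y hy t β ?_)
      rw [sub_eq_zero] at h0
      rw [h0] at hαβ
      exact (add_left_cancel hαβ).symm
    · exact Submodule.mem_span_pair.2 ⟨-α, s, by module⟩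
    · refine Submodule.mem_span_pair.2 ⟨β, -t, ?_⟩
      rw [eq_sub_iff_add_eq, neg_smul, ← sub_eq_add_neg, sub_add_eq_add_sub, sub_eq_iff_eq_add,
        add_comm (β • y), hαβ]
  have hPdim : ∀ x, Module.finrank ℝ (P x) ≤ 2 := fun x => finrank_span_pair_le x (p x)
  have hPmem : ∀ x, x ∈ P x := fun x => Submodule.subset_span (by simp)
  have hmeet : ∀ y y', y ≠ 0 → y' ≠ 0 → ∃ w, w ≠ 0 ∧ w ∈ P y ∧ w ∈ P y' := by
    intro y y' hy hy'
    obtain ⟨x₀, hx₀, hx₀'⟩ := exists_ne_zero_forall_inner_eq_zero {(a y : V), (a y' : V), y, y'}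
      (Finset.card_le_four.trans_lt (by omega))
    have hf := hN.eventually_failsOnOrthogonal hx₀ (hx₀' y (by simp))
      (hfails x₀ y hy (by rw [real_inner_comm]; exact hx₀' _ (by simp)))
    have hf' := hN.eventually_failsOnOrthogonal hx₀ (hx₀' y' (by simp))
      (hfails x₀ y' hy' (by rw [real_inner_comm]; exact hx₀' _ (by simp)))
    -- The span of the two planes is too small to contain all vectors near `x₀`.
    set T := P y ⊔ P y' with hT
    have hTtop : T ≠ ⊤ := by
      intro h
      have h1 := Submodule.finrank_add_le_finrank_add_finrank (P y) (P y')
      rw [← hT, h, finrank_top] at h1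
      have := hPdim y
      have := hPdim y'
      omega
    obtain ⟨d, hd⟩ : ∃ d, ∀ t : ℝ, t ≠ 0 → x₀ + t • d ∉ T := by
      by_cases hx₀T : x₀ ∈ T
      · obtain ⟨d, hd⟩ := exists_notMem_of_ne_top T hTtop
        exact ⟨d, fun t ht h => hd ((T.smul_mem_iff ht).1 ((T.add_mem_iff_right hx₀T).1 h))⟩
      · exact ⟨0, fun t _ => by simpa using hx₀T⟩
    have hlim : Tendsto (fun t : ℝ => x₀ + t • d) (𝓝[≠] 0) (𝓝 x₀) := by
      have : Continuous fun t : ℝ => x₀ + t • d := by fun_prop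
      simpa using (this.tendsto 0).mono_left nhdsWithin_le_nhds
    obtain ⟨t, ⟨ht1, ht2⟩, ht0⟩ :=
      ((hlim.eventually (hf.and hf')).and self_mem_nhdsWithin).exists
    set x := x₀ + t • d with hx
    have hxT : x ∉ T := hd t ht0
    have hx0 : x ≠ 0 := fun h => hxT (h ▸ T.zero_mem)
    obtain ⟨w, hw0, hwx, hwy⟩ := hmeet' x y hx0 hy ht1
    obtain ⟨w', hw'0, hw'x, hw'y⟩ := hmeet' x y' hx0 hy' ht2
    obtain ⟨r, hr⟩ := exists_eq_smul_of_finrank_le_two (hPdim x) (hPmem x) hxT hwx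
      ((le_sup_left : P y ≤ T) hwy) hw0 hw'x ((le_sup_right : P y' ≤ T) hw'y)
    exact ⟨w', hw'0, hr ▸ (P y).smul_mem r hwy, hw'y⟩
  obtain ⟨z, hz0, hz⟩ := exists_common_vector (by omega) P hPdim hPmem hmeet
  -- Two vectors `u`, `v` orthogonal to `z` lie on the equator of the hyperplane orthogonal to `x`,
  -- for any `x` orthogonal to `u`, `v` and `z`.
  have hpar : SatisfiesParallelogram (N ∘ (Subtype.val : (Submodule.span ℝ {z})ᗮ → V)) := by
    intro u v
    have hzu : ⟪z, (u : V)⟫ = 0 := Submodule.mem_orthogonal_singleton_iff_inner_right.1 u.2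
    have hzv : ⟪z, (v : V)⟫ = 0 := Submodule.mem_orthogonal_singleton_iff_inner_right.1 v.2
    obtain ⟨x, hx0, hx⟩ := exists_ne_zero_forall_inner_eq_zero {(u : V), (v : V), z}
      (Finset.card_le_three.trans_lt (by omega))
    have hxu : ⟪x, (u : V)⟫ = 0 := by rw [real_inner_comm]; exact hx _ (by simp)
    have hxv : ⟪x, (v : V)⟫ = 0 := by rw [real_inner_comm]; exact hx _ (by simp)
    have hzx : ⟪z, x⟫ = 0 := hx z (by simp)
    obtain ⟨α, β, hαβ⟩ := Submodule.mem_span_pair.1 (hz x hx0)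
    have hβ : β ≠ 0 := by
      rintro rfl
      refine hz0 (inner_self_eq_zero (𝕜 := ℝ).1 ?_)
      nth_rw 2 [← hαβ]
      simp [inner_smul_right, hzx]
    set W := (Submodule.span ℝ {x, z})ᗮ with hW
    have hWx : W ≤ (Submodule.span ℝ {x})ᗮ := Submodule.orthogonal_le
      (Submodule.span_mono (by simp))
    have h1 := (hA x hx0).comp (Submodule.inclusion hWx) (Submodule.inclusion_injective hWx)
    have h2 : (innerₗ V (p x) ∘ₗ (Submodule.span ℝ {x})ᗮ.subtype) ∘ₗ Submodule.inclusion hWx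
        = 0 := by
      refine LinearMap.ext fun m => ?_
      have h3 := mem_orthogonal_span_pair.1 m.2
      have h4 := h3.2
      rw [← hαβ, inner_add_left, real_inner_smul_left, real_inner_smul_left, h3.1, mul_zero,
        zero_add] at h4
      exact (mul_eq_zero.1 h4).resolve_left hβ
    rw [h2] at h1
    obtain ⟨c, -, hc⟩ := h1.eq_const_mul (hgauge W)
    exact satisfiesParallelogram_of_eq_const_mul hc ⟨u, mem_orthogonal_span_pair.2 ⟨hxu, hzu⟩⟩
      ⟨v, mem_orthogonal_span_pair.2 ⟨hxv, hzv⟩⟩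
  obtain ⟨w, hw0, hw⟩ := exists_ne_zero_forall_inner_eq_zero {z, p z}
    (Finset.card_le_two.trans_lt (by omega))
  obtain ⟨S, hS⟩ := (hA z hz0).exists_eq_norm (hgauge _) (a := a z)
    (w := ⟨w, Submodule.mem_orthogonal_singleton_iff_inner_right.2 (hw z (by simp))⟩)
    (ha z hz0).2 (ha z hz0).1 (hw (p z) (by simp)) (fun h => hw0 (congrArg Subtype.val h))
    (fun s t => hpar _ _)
  obtain ⟨u, hu⟩ := hno z hz0 S
  exact hu (hS u)

end Gauge

/-! ### Support functions of bodies of revolution -/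

section Bodies

variable {V : Type*} [NormedAddCommGroup V] [InnerProductSpace ℝ V]

/-- The support function of `B` with respect to the origin `c`. -/
noncomputable def supportFunction (B : Set V) (c u : V) : ℝ :=
  sSup ((fun b => ⟪b - c, u⟫) '' B)

theorem inner_le_supportFunction {B : Set V} (hB : IsCompact B) {b : V} (hb : b ∈ B) (c u : V) :
    ⟪b - c, u⟫ ≤ supportFunction B c u :=
  le_csSup (hB.image (by fun_prop : Continuous fun b => ⟪b - c, u⟫)).bddAbove ⟨b, hb, rfl⟩

theorem exists_inner_eq_supportFunction {B : Set V} (hB : IsCompact B) (hne : B.Nonempty)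
    (c u : V) : ∃ b ∈ B, ⟪b - c, u⟫ = supportFunction B c u :=
  (hB.image (by fun_prop : Continuous fun b => ⟪b - c, u⟫)).sSup_mem (hne.image _)

theorem IsConvexBody.nonempty {B : Set V} (hB : IsConvexBody B) : B.Nonempty :=
  hB.nonempty_interior.mono interior_subset

theorem add_sub_mem_of_image_pointReflection_eq {V : Type*} [NormedAddCommGroup V]
    {B : Set V} {c : V}
    (h : Equiv.pointReflection c '' B = B) {b : V} (hb : b ∈ B) : c + c - b ∈ B := by
  rw [← h]
  refine ⟨b, hb, ?_⟩
  rw [Equiv.pointReflection_apply, vsub_eq_sub, vadd_eq_add]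
  abel

theorem IsConvexBody.isGauge_supportFunction {B : Set V} (hB : IsConvexBody B) {c : V}
    (hc : ∀ b ∈ B, c + c - b ∈ B) : IsGauge (supportFunction B c) := by
  have hle := fun {b} (hb : b ∈ B) u => inner_le_supportFunction hB.isCompact hb c u
  have hex := exists_inner_eq_supportFunction hB.isCompact hB.nonempty c
  have hneg : ∀ u, supportFunction B c (-u) ≤ supportFunction B c u := by
    intro u
    obtain ⟨b, hb, h⟩ := hex (-u)
    rw [← h]
    refine le_trans (le_of_eq ?_) (hle (hc b hb) u)
    rw [inner_neg_right, ← inner_neg_left]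
    congr 1
    abel
  have hpossmul : ∀ t : ℝ, 0 ≤ t → ∀ u,
      supportFunction B c (t • u) = t * supportFunction B c u := by
    intro t ht u
    obtain ⟨b, hb, h⟩ := hex (t • u)
    obtain ⟨b', hb', h'⟩ := hex u
    refine le_antisymm ?_ ?_
    · rw [← h, inner_smul_right]
      exact mul_le_mul_of_nonneg_left (hle hb u) ht
    · rw [← h', ← inner_smul_right]
      exact hle hb' _
  refine ⟨?_, fun t u => ?_, fun u hu => ?_⟩
  · exact hB.isCompact.continuous_sSup (f := fun u b => ⟪b - c, u⟫) (by fun_prop)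
  · rcases le_total 0 t with ht | ht
    · rw [abs_of_nonneg ht, hpossmul t ht]
    · have h1 := hpossmul (-t) (neg_nonneg.2 ht) u
      rw [abs_of_nonpos ht, ← h1, neg_smul]
      exact le_antisymm (by simpa using hneg (-(t • u))) (hneg _)
  · obtain ⟨b, hb⟩ := hB.nonempty_interior
    obtain ⟨ε, hε, hball⟩ := Metric.mem_nhds_iff.1 (mem_interior_iff_mem_nhds.1 hb)
    have hu' : 0 < ‖u‖ := norm_pos_iff.2 hu
    set δ := ε / 2 / ‖u‖ with hδ
    have hδ0 : 0 < δ := by positivity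
    have hδu : ‖δ • u‖ < ε := by
      rw [norm_smul, Real.norm_of_nonneg hδ0.le, hδ, div_mul_cancel₀ _ hu'.ne']
      linarith
    have h1 : b + δ • u ∈ B := hball (by simpa [Metric.mem_ball, dist_eq_norm] using hδu)
    have h2 : b - δ • u ∈ B := hball (by simpa [Metric.mem_ball, dist_eq_norm] using hδu)
    have h3 := hle h1 u
    have h4 := hle (hc _ h2) u
    have h5 : ⟪b + δ • u - c, u⟫ + ⟪c + c - (b - δ • u) - c, u⟫ = 2 * δ * ‖u‖ ^ 2 := by
      rw [← inner_add_left, ← real_inner_self_eq_norm_sq, ← real_inner_smul_left]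
      congr 1
      module
    have h6 : 0 < 2 * δ * ‖u‖ ^ 2 := by positivity
    linarith

/-- A body of revolution is preserved by the isometries that fix its axis pointwise. -/
theorem IsAxisOfRevolution.add_mem [FiniteDimensional ℝ V] {L : AffineSubspace ℝ V} {K : Set V}
    (h : IsAxisOfRevolution L K) (g : V ≃ₗᵢ[ℝ] V) (hg : ∀ d ∈ L.direction, g d = d) {x₀ : V}
    (hx₀ : x₀ ∈ L) {k : V} (hk : k ∈ K) : x₀ + g (k - x₀) ∈ K := by
  set D := L.direction with hD
  -- `x` is the foot of the perpendicular from `k` to the axis.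
  set d := D.starProjection (k - x₀) with hd
  have hdD : d ∈ D := Submodule.starProjection_apply_mem D _
  set x := x₀ + d with hx
  have hxL : x ∈ L := by
    rw [hx, add_comm]
    exact AffineSubspace.vadd_mem_of_mem_direction hdD hx₀
  have hperp : k - x ∈ Dᗮ := by
    have := Submodule.sub_starProjection_mem_orthogonal (K := D) (k - x₀)
    rwa [← hd, sub_sub, ← hx] at this
  obtain ⟨r, hr⟩ := h.2.2 x hxL
  have hkr : k ∈ Metric.closedBall x r := by
    have : k ∈ K ∩ (AffineSubspace.mk' x Dᗮ : Set V) :=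
      ⟨hk, AffineSubspace.mem_mk'.2 (by simpa using hperp)⟩
    rw [hr] at this
    exact this.1
  have heq : x₀ + g (k - x₀) = x + g (k - x) := by
    rw [hx, ← sub_sub, map_sub g (k - x₀) d, hg d hdD]
    abel
  have hgperp : g (k - x) ∈ Dᗮ := fun m hm => by
    rw [← hg m hm, g.inner_map_map]
    exact hperp m hm
  have : x + g (k - x) ∈ K ∩ (AffineSubspace.mk' x Dᗮ : Set V) := by
    rw [hr]
    refine ⟨?_, AffineSubspace.mem_mk'.2 (by simpa using hgperp)⟩
    rw [Metric.mem_closedBall, dist_eq_norm] at hkr ⊢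
    rwa [add_sub_cancel_left, g.norm_map]
  rw [heq]
  exact this.1

/-- The centre of a symmetric body of revolution lies on every axis of revolution: otherwise the
half turn about the axis followed by the point reflection would move the body further and further
in the direction from the axis to the centre. -/
theorem IsAxisOfRevolution.center_mem [FiniteDimensional ℝ V] {L : AffineSubspace ℝ V} {K : Set V}
    (h : IsAxisOfRevolution L K) (hK : IsCompact K) (hne : K.Nonempty) {c : V}
    (hc : ∀ k ∈ K, c + c - k ∈ K) : c ∈ L := by
  obtain ⟨x₀, hx₀⟩ := h.1
  set D := L.direction with hD
  set p := D.starProjection (c - x₀) with hp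
  have hpD : p ∈ D := Submodule.starProjection_apply_mem D _
  set x := x₀ + p with hx
  have hxL : x ∈ L := by
    rw [hx, add_comm]
    exact AffineSubspace.vadd_mem_of_mem_direction hpD hx₀
  set d := c - x with hd
  have hperp : d ∈ Dᗮ := by
    have := Submodule.sub_starProjection_mem_orthogonal (K := D) (c - x₀)
    rwa [← hp, sub_sub, ← hx] at this
  have hfix : ∀ m ∈ L.direction, D.reflection m = m := fun m hm =>
    Submodule.reflection_mem_subspace_eq_self hm
  obtain ⟨k, hk, hmax⟩ := hK.exists_isMaxOn hne
    (by fun_prop : ContinuousOn (fun k => ⟪d, k⟫) K)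
  have h1 := hmax (hc _ (h.add_mem D.reflection hfix hxL hk))
  have h2 : ⟪d, D.reflection (k - x)⟫ = -⟪d, k - x⟫ := by
    rw [← D.reflection.inner_map_map d (k - x),
      Submodule.reflection_mem_subspace_orthogonalComplement_eq_neg hperp, inner_neg_left, neg_neg]
  have h3 : c + c - (x + D.reflection (k - x)) = 2 • d + (x - D.reflection (k - x)) := by
    rw [hd, two_smul]; abel
  have h4 : ‖d‖ ^ 2 ≤ 0 := by
    simp only [Set.mem_ofPred_eq, h3, inner_add_right, inner_sub_right, h2, two_smul,
      real_inner_self_eq_norm_sq] at h1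
    linarith
  have h5 : d = 0 := by
    have := le_antisymm h4 (sq_nonneg _)
    simpa using this
  rw [sub_eq_zero.1 h5]
  exact hxL

/-- On the hyperplane `H`, the support function of `B` is invariant under affine rotations when the
projection of `B` to `H` is an affine body of revolution. If `T` is the linear part of the
affine map that straightens the projection, the Euclidean structure is given by the inverse of the
adjoint of `T`. -/
theorem exists_isRotationInvariant [FiniteDimensional ℝ V] {B : Set V} (hB : IsConvexBody B) {c : V}
    (hc : ∀ b ∈ B, c + c - b ∈ B) {H : Submodule ℝ V}
    (h : IsAffineBodyOfRevolution (orthProj H B)) :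
    ∃ (A : H →ₗ[ℝ] H) (p : V), IsRotationInvariant (supportFunction B c ∘ Subtype.val) A
      (innerₗ V p ∘ₗ H.subtype) := by
  obtain ⟨-, f, hbody, L, hL⟩ := h
  set q := H.orthogonalProjectionOnto with hq
  set T := f.linear with hT
  have hf : ∀ b, f (q b) - f (q c) = T (q (b - c)) := fun b => by
    rw [map_sub q]
    exact (f.toAffineMap.linearMap_vsub (q b) (q c)).symm
  have hcL : f (q c) ∈ L := by
    refine hL.center_mem hbody.isCompact hbody.nonempty ?_
    rintro _ ⟨_, ⟨b, hb, rfl⟩, rfl⟩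
    refine ⟨_, ⟨_, hc b hb, rfl⟩, ?_⟩
    have h1 := hf (c + c - b)
    have h2 := hf b
    have h3 : c + c - b - c = -(b - c) := by abel
    rw [h3, map_neg, map_neg, ← h2] at h1
    rw [← sub_eq_zero] at h1 ⊢
    rw [← h1]
    change f (q (c + c - b)) - _ = _
    abel
  obtain ⟨e, -, he⟩ := finrank_eq_one_iff'.1 hL.2.1
  let A : H →ₗ[ℝ] H := LinearMap.adjoint (T.symm : H →ₗ[ℝ] H)
  have hA : ∀ y u, ⟪T y, A u⟫ = ⟪y, u⟫ := fun y u => by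
    rw [LinearMap.adjoint_inner_right]
    simp
  have hAinj : Function.Injective A := by
    refine (injective_iff_map_eq_zero A).2 fun u hu => ?_
    have := hA u u
    rw [hu, inner_zero_right] at this
    exact inner_self_eq_zero.1 this.symm
  have hsup : ∀ (b : V) (u : H), ⟪b - c, (u : V)⟫ = ⟪T (q (b - c)), A u⟫ := fun b u => by
    rw [hA, Submodule.inner_orthogonalProjectionOnto_eq_of_mem_right]
  have key : ∀ u v : H, ‖A u‖ = ‖A v‖ → ⟪(e : H), A u⟫ = ⟪(e : H), A v⟫ →
      supportFunction B c u ≤ supportFunction B c v := by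
    intro u v huv heuv
    obtain ⟨b, hb, hbu⟩ := exists_inner_eq_supportFunction hB.isCompact hB.nonempty c (u : V)
    set g := (Submodule.span ℝ {A u - A v})ᗮ.reflection with hg
    have hguv : g (A u) = A v := Submodule.reflection_sub huv
    have hfix : ∀ d ∈ L.direction, g d = d := by
      intro d hd
      refine Submodule.reflection_mem_subspace_eq_self
        (Submodule.mem_orthogonal_singleton_iff_inner_left.2 ?_)
      obtain ⟨t, ht⟩ := he ⟨d, hd⟩
      have ht' : t • (e : H) = d := congrArg Subtype.val ht
      rw [← ht', real_inner_smul_left, inner_sub_right, heuv, sub_self, mul_zero]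
    obtain ⟨_, ⟨b', hb', rfl⟩, hbb'⟩ := hL.add_mem g hfix hcL ⟨q b, ⟨b, hb, rfl⟩, rfl⟩
    have h1 : T (q (b' - c)) = g (T (q (b - c))) := by
      rw [← hf b', ← hf b]
      exact sub_eq_iff_eq_add'.2 hbb'
    rw [← hbu, hsup, ← g.inner_map_map, hguv, ← h1, ← hsup]
    exact inner_le_supportFunction hB.isCompact hb' c (v : V)
  refine ⟨A, ((T.symm e : H) : V), hAinj, fun u v huv hpuv => ?_⟩
  have he' : ∀ u : H, ⟪((T.symm e : H) : V), (u : V)⟫ = ⟪(e : H), A u⟫ := fun u => by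
    rw [← Submodule.coe_inner, ← hA, LinearEquiv.apply_symm_apply]
  have hpuv' : ⟪(e : H), A u⟫ = ⟪(e : H), A v⟫ := by
    rw [← he', ← he']; exact hpuv
  exact le_antisymm (key u v huv hpuv') (key v u huv.symm hpuv'.symm)

/-- A closed convex set whose support function is Euclidean is an ellipsoid: it is determined by its
support function, which is that of the image of the unit ball under the adjoint of `S`. -/
theorem isEllipsoid_of_support [FiniteDimensional ℝ V] {K : Set V} (hK : IsClosed K)
    (hconv : Convex ℝ K) {c : V} {S : V →ₗ[ℝ] V} (hS : Function.Injective S)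
    (hle : ∀ k ∈ K, ∀ u, ⟪k - c, u⟫ ≤ ‖S u‖) (hex : ∀ u, ∃ k ∈ K, ⟪k - c, u⟫ = ‖S u‖) :
    IsEllipsoid K := by
  have hSsurj : Function.Surjective S := LinearMap.injective_iff_surjective.1 hS
  have hadj : Function.Injective (LinearMap.adjoint S) := by
    refine (injective_iff_map_eq_zero _).2 fun y hy => ?_
    obtain ⟨u, hu⟩ := hSsurj y
    have := LinearMap.adjoint_inner_left S u y
    rw [hy, hu, inner_zero_left] at this
    exact inner_self_eq_zero.1 this.symm
  let R : V ≃ₗ[ℝ] V := LinearEquiv.ofInjectiveEndo (LinearMap.adjoint S) hadj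
  have hR : ∀ y u, ⟪R y, u⟫ = ⟪y, S u⟫ := fun y u => LinearMap.adjoint_inner_left S u y
  refine ⟨R.toAffineEquiv.trans (AffineEquiv.constVAdd ℝ V c), Set.ext fun k => ⟨fun hk => ?_, ?_⟩⟩
  · refine ⟨R.symm (k - c), ?_, by simp⟩
    rw [mem_closedBall_zero_iff]
    obtain ⟨u, hu⟩ := hSsurj (R.symm (k - c))
    have h1 := hle k hk u
    have h2 := hR (R.symm (k - c)) u
    rw [LinearEquiv.apply_symm_apply] at h2
    rw [h2, hu, real_inner_self_eq_norm_sq] at h1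
    nlinarith [norm_nonneg (R.symm (k - c))]
  · rintro ⟨y, hy, rfl⟩
    rw [mem_closedBall_zero_iff] at hy
    simp only [AffineEquiv.trans_apply, LinearEquiv.coe_toAffineEquiv, AffineEquiv.constVAdd_apply,
      vadd_eq_add]
    by_contra hnot
    obtain ⟨φ, s, hφ, hs⟩ := geometric_hahn_banach_closed_point hconv hK hnot
    set u := (InnerProductSpace.toDual ℝ V).symm φ with hu
    have hφu : ∀ w, φ w = ⟪w, u⟫ := fun w => by
      rw [real_inner_comm, hu, InnerProductSpace.toDual_symm_apply]
    obtain ⟨k, hk, hku⟩ := hex u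
    have h1 := (hφ k hk).trans hs
    rw [hφu, hφu, inner_add_left, hR] at h1
    rw [inner_sub_left] at hku
    have h2 : ⟪y, S u⟫ ≤ ‖S u‖ := (real_inner_le_norm y (S u)).trans
      (mul_le_of_le_one_left (norm_nonneg _) hy)
    linarith

end Bodies

theorem mainTheorem7 (n : ℕ) (hn : 4 ≤ n) (B : Set (EuclideanSpace ℝ (Fin (n + 1))))
    (hB : IsConvexBody B) (hsymm : IsCentrallySymmetric B)
    (hproj : ∀ H : Submodule ℝ (EuclideanSpace ℝ (Fin (n + 1))),
      Module.finrank ℝ H = n → IsAffineBodyOfRevolution (orthProj H B)) :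
    ∃ H : Submodule ℝ (EuclideanSpace ℝ (Fin (n + 1))),
      Module.finrank ℝ H = n ∧ IsEllipsoid (orthProj H B) := by
  obtain ⟨c, hc⟩ := hsymm
  have hc' : ∀ b ∈ B, c + c - b ∈ B := fun b hb => add_sub_mem_of_image_pointReflection_eq hc hb
  have hN := hB.isGauge_supportFunction hc'
  have hdim : ∀ x : EuclideanSpace ℝ (Fin (n + 1)), x ≠ 0 →
      Module.finrank ℝ (Submodule.span ℝ {x})ᗮ = n := fun x hx => by
    have h1 := (Submodule.span ℝ {x}).finrank_add_finrank_orthogonal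
    rw [finrank_span_singleton hx, finrank_euclideanSpace_fin] at h1
    omega
  obtain ⟨H, hH, S, hS⟩ : ∃ H : Submodule ℝ (EuclideanSpace ℝ (Fin (n + 1))),
      Module.finrank ℝ H = n ∧ ∃ S : H →ₗ[ℝ] H, ∀ u : H, supportFunction B c u = ‖S u‖ := by
    obtain ⟨x, hx, S, hS⟩ := hN.exists_euclidean_hyperplane
      (by rw [finrank_euclideanSpace_fin]; omega)
      fun x hx => exists_isRotationInvariant hB hc' (hproj _ (hdim x hx))
    exact ⟨_, hdim x hx, S, hS⟩
  have hSinj : Function.Injective S := by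
    refine (injective_iff_map_eq_zero S).2 fun u hu => ?_
    by_contra hu0
    have h1 := hN.pos (u : EuclideanSpace ℝ (Fin (n + 1))) fun h => hu0 (Subtype.ext h)
    rw [hS, hu, norm_zero] at h1
    exact h1.false
  have hq : ∀ b (u : H), ⟪H.orthogonalProjectionOnto b - H.orthogonalProjectionOnto c, u⟫ =
      ⟪b - c, (u : EuclideanSpace ℝ (Fin (n + 1)))⟫ := fun b u => by
    rw [← map_sub, Submodule.inner_orthogonalProjectionOnto_eq_of_mem_right]
  obtain ⟨hK, -⟩ := hproj H hH
  refine ⟨H, hH, isEllipsoid_of_support hK.isCompact.isClosed hK.convex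
    (c := H.orthogonalProjectionOnto c) hSinj ?_ fun u => ?_⟩
  · rintro _ ⟨b, hb, rfl⟩ u
    rw [hq, ← hS]
    exact inner_le_supportFunction hB.isCompact hb c _
  · obtain ⟨b, hb, h⟩ := exists_inner_eq_supportFunction hB.isCompact hB.nonempty c
      (u : EuclideanSpace ℝ (Fin (n + 1)))
    exact ⟨_, ⟨b, hb, rfl⟩, by rw [hq, ← hS, h]⟩
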